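/- Let $\mathcal A$ be a finite alphabet with $n$ elements $a_1,\dots,a_n$. The square grid is the graph on $\mathbb Z^2$ in which $\vec u$ and $\vec v$ are adjacent if and only if $\vec u-\vec v\in\{(\pm1,0),(0,\pm1)\}$, and $D=\{(0,0),(\pm1,0),(0,\pm1)\}$ is its relative $1$-neighborhood, i.e. the set of vertices at graph distance at most $1$ from the origin. A configuration $c\in\mathcal A^{\mathbb Z^2}$ is a $D$-perfect coloring with matrix $\mathbf B=(b_{ij})\in\mathbb Z^{n\times n}$ if for all $i,j\in\{1,\dots,n\}$ and every $\vec u\in\mathbb Z^2$ with $c_{\vec u}=a_j$, exactly $b_{ij}$ cells of $\vec u+D$ have color $a_i$. It is a $1$-perfect coloring of the square grid with matrix $\mathbf B$ if for all $i,j$ the number of vertices of color $a_i$ at graph distance at most $1$ from any vertex of color $a_j$ is exactly $b_{ij}$. A configuration is two-periodic if there are two linearly independent vectors $\vec t\in\mathbb Z^2$ such that $c_{\vec u-\vec t}=c_{\vec u}$ for all $\vec u\in\mathbb Z^2$. **Corollary.** Every $D$-perfect coloring with matrix $\mathbf B$ is two-periodic whenever $\det(\mathbf B-\mathbf I)\neq0$.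 In other words, every $1$-perfect coloring of the square grid with matrix $\mathbf B$ is two-periodic whenever $\det(\mathbf B-\mathbf I)\neq0$. -/

import Mathlib

/-- The `d`-dimensional configurations over the alphabet `A`. -/
abbrev Configuration (d : ℕ) (A : Type*) := (Fin d → ℤ) → A

/-- The translation of a configuration by the vector `t`. -/
def Configuration.translate {d : ℕ} {A : Type*} (t : Fin d → ℤ) (c : Configuration d A) :
    Configuration d A :=
  fun u => c (u - t)

/-- `t` is a vector of periodicity of `c`. -/
def Configuration.IsPeriodicBy {d : ℕ} {A : Type*} (c : Configuration d A) (t : Fin d → ℤ) : Prop :=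
  c.translate t = c

/-- `c` has `d` linearly independent vectors of periodicity. -/
def Configuration.IsStronglyPeriodic {d : ℕ} {A : Type*} (c : Configuration d A) : Prop :=
  ∃ t : Fin d → (Fin d → ℤ), LinearIndependent ℤ t ∧ ∀ i, c.IsPeriodicBy (t i)

/-- Two-periodic: strongly periodic, in dimension two. -/
def Configuration.IsTwoPeriodic {A : Type*} (c : Configuration 2 A) : Prop :=
  c.IsStronglyPeriodic

/-- `c` is a perfect coloring with respect to the finite shape `D`, with matrix `B`: the pattern of
`c` on `u + D` contains exactly `B i j` cells of color `i` whenever `u` has color `j`. -/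
def Configuration.IsPerfectColoring {d : ℕ} {A : Type*} (c : Configuration d A)
    (D : Set (Fin d → ℤ)) (B : Matrix A A ℤ) : Prop :=
  D.Finite ∧ ∀ (i j : A) (u : Fin d → ℤ), c u = j →
    (({v ∈ (fun w => u + w) '' D | c v = i}.ncard : ℕ) : ℤ) = B i j

/-- The vertices at graph distance at most `r` from `u` (the extended distance is used, so that
vertices in other components are never counted). -/
def graphNeighborhood {V : Type*} (G : SimpleGraph V) (r : ℕ) (u : V) : Set V :=
  {v | G.edist v u ≤ (r : ℕ∞)}

/-- `φ` is an `r`-perfect coloring of the graph `G` with matrix `B`: the (finite) `r`-neighborhood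
of a vertex of color `j` contains exactly `B i j` vertices of color `i`. -/
def IsGraphPerfectColoring {V A : Type*} (G : SimpleGraph V) (r : ℕ) (φ : V → A)
    (B : Matrix A A ℤ) : Prop :=
  (∀ u, (graphNeighborhood G r u).Finite) ∧ ∀ (i j : A) (u : V), φ u = j →
    (({v ∈ graphNeighborhood G r u | φ v = i}.ncard : ℕ) : ℤ) = B i j

/-- The relative `r`-neighborhood of a graph on `ℤ^d`: the `r`-neighborhood of the origin. -/
def relativeNeighborhood {d : ℕ} (G : SimpleGraph (Fin d → ℤ)) (r : ℕ) : Set (Fin d → ℤ) :=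
  graphNeighborhood G r 0

/-- The square grid. -/
def squareGrid : SimpleGraph (Fin 2 → ℤ) where
  Adj u v := u - v ∈ ({![1, 0], ![-1, 0], ![0, 1], ![0, -1]} : Set (Fin 2 → ℤ))
  symm := ⟨fun u v h => by
    rw [← neg_sub u v]
    simp only [Set.mem_insert_iff, Set.mem_singleton_iff] at h ⊢
    rcases h with h | h | h | h <;> rw [h] <;> simp⟩
  loopless := ⟨fun u h => by
    simp only [sub_self, Set.mem_insert_iff, Set.mem_singleton_iff] at h
    rcases h with h | h | h | h
    · simpa using congrFun h 0
    · simpa using congrFun h 0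
    · simpa using congrFun h 1
    · simpa using congrFun h 1⟩

/-! Let x, y be the unit shifts, T = x + x⁻¹ + y + y⁻¹, M = B - I. As M counts the proper neighbors,
T acts on the functions w ∘ c through M, and Cayley-Hamilton gives P(T)(w ∘ c) = 0 for P the
characteristic polynomial of M. Modulo a prime p, P(xᵖ + x⁻ᵖ + yᵖ + y⁻ᵖ) is P(T)ᵖ; since w ∘ c is
bounded, this operator also kills w ∘ c when p is large (`exists_prime_aeval_gridPowerSum_mem`).

Over ℂ the two relations eliminate y (`exists_aeval_mem_of_laurent`). Modulo T - l with P(l) = 0, y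
+ y⁻¹ is l - (x + x⁻¹), and the Dickson polynomial D sends it to yᵖ + y⁻ᵖ. What remains is P(D(X) +
D(l - X)) at X = x + x⁻¹. The inner sum is nonconstant for l ≠ 0 but vanishes for l = 0, which det M
≠ 0 excludes. The result is a linear recurrence for c along x, which over a finite alphabet forces a
period (`exists_periodic_of_aeval_mem`). Exchanging x and y gives the second period. -/

namespace Polynomial

/-! ### Dickson polynomials and elimination of a variable. -/

theorem eval_dickson_one_one_neg {p : ℕ} (hp : Odd p) (u : ℂ) :
    (dickson 1 (1 : ℂ) p).eval (-u) = -(dickson 1 (1 : ℂ) p).eval u := by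
  -- Write u = z + z⁻¹; then D(u) = zᵖ + z⁻ᵖ is odd in z.
  obtain ⟨z, hz⟩ := IsAlgClosed.exists_root (X ^ 2 - C u * X + 1 : ℂ[X]) (by
    have : (X ^ 2 - C u * X + 1 : ℂ[X]).degree = 2 := by compute_degree!
    rw [this]; norm_num)
  have hz : z * (u - z) = 1 := by
    simp only [IsRoot, eval_add, eval_sub, eval_pow, eval_X, eval_mul, eval_C, eval_one] at hz
    linear_combination -hz
  have h₁ := dickson_one_one_eval_add_inv z (u - z) hz p
  have h₂ := dickson_one_one_eval_add_inv (-z) (-(u - z)) (by linear_combination hz) p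
  rw [hp.neg_pow, hp.neg_pow] at h₂
  rw [show u = z + (u - z) by ring, h₁, show -(z + (u - z)) = -z + -(u - z) by ring, h₂]
  ring

/-- For odd `p ≥ 3` and `l ≠ 0`, the polynomial `D(X) + D(l - X)`, with `D` the Dickson polynomial of
index `p`, is not constant. -/
theorem dickson_add_comp_ne_C {p : ℕ} (hp : Odd p) (hp3 : 3 ≤ p) {l : ℂ} (hl : l ≠ 0) (m : ℂ) :
    dickson 1 (1 : ℂ) p + (dickson 1 (1 : ℂ) p).comp (C l - X) ≠ C m := by
  intro h
  set D := dickson 1 (1 : ℂ) p with hD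
  have hneg : ∀ u, D.eval (-u) = -D.eval u := eval_dickson_one_one_neg hp
  have hzero : D.eval 0 = 0 := by
    have := hneg 0
    rw [neg_zero] at this
    linear_combination this / 2
  -- By oddness D(u + l) - D(u) is constant, so D is linear on the multiples of l, hence everywhere;
  -- its values at 1 + 1 and 2 + 1/2 refute this.
  have hstep : ∀ u, D.eval (u + l) = D.eval u + m := fun u => by
    have := congrArg (eval (-u)) h
    simp only [eval_add, eval_comp, eval_sub, eval_C, eval_X, hneg, sub_neg_eq_add] at this
    rw [add_comm u l]
    linear_combination this
  have hmul : ∀ n : ℕ, D.eval (n * l) = n * m := fun n => by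
    induction n with
    | zero => simpa using hzero
    | succ n ih =>
      push_cast
      rw [add_mul, one_mul, hstep, ih]
      ring
  have hlin : D = C (m / l) * X := by
    refine eq_of_infinite_eval_eq _ _ (Set.infinite_of_injective_forall_mem
      (f := fun n : ℕ => (n : ℂ) * l) (fun a b hab => ?_) fun n => ?_)
    · exact_mod_cast mul_right_cancel₀ hl hab
    · simp only [Set.mem_ofPred_eq, hmul, eval_mul, eval_C, eval_X]
      field_simp
  have h2 : D.eval (1 + 1) = 1 ^ p + 1 ^ p := dickson_one_one_eval_add_inv 1 1 (by norm_num) p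
  have h5 : D.eval (2 + 1 / 2) = 2 ^ p + (1 / 2) ^ p :=
    dickson_one_one_eval_add_inv 2 (1 / 2) (by norm_num) p
  simp only [hlin, eval_mul, eval_C, eval_X, one_pow] at h2 h5
  have hml : m / l = 1 := by linear_combination h2 / 2
  rw [hml] at h5
  have h5' : (2 + 1 / 2 : ℝ) = 2 ^ p + (1 / 2) ^ p := by
    have : ((2 + 1 / 2 : ℝ) : ℂ) = ((2 ^ p + (1 / 2) ^ p : ℝ) : ℂ) := by
      push_cast
      linear_combination h5
    exact_mod_cast this
  have h8 : (2 : ℝ) ^ 3 ≤ 2 ^ p := pow_le_pow_right₀ (by norm_num) hp3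
  have : (0 : ℝ) < (1 / 2) ^ p := by positivity
  norm_num at h8
  linarith

/-- Elimination of one variable: if an ideal contains the values of a polynomial with nonzero
constant coefficient at `x + x⁻¹ + y + y⁻¹` and at `xᵖ + x⁻ᵖ + yᵖ + y⁻ᵖ`, then it contains the value
of a nonzero polynomial at `x`. -/
theorem exists_aeval_mem_of_laurent {R : Type*} [CommRing R] [Algebra ℂ R] (I : Ideal R)
    {x x' y y' : R} (hx : x * x' = 1) (hy : y * y' = 1) {P : ℂ[X]} (hP : P.Monic)
    (hP0 : P.eval 0 ≠ 0) {p : ℕ} (hp : Odd p) (hp3 : 3 ≤ p)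
    (h₁ : aeval (x + x' + y + y') P ∈ I)
    (h₂ : aeval (x ^ p + x' ^ p + y ^ p + y' ^ p) P ∈ I) :
    ∃ Q : ℂ[X], Q ≠ 0 ∧ aeval x Q ∈ I := by
  set D := dickson 1 (1 : ℂ) p with hD
  set S : ℂ → ℂ[X] := fun l => P.comp (D + D.comp (C l - X)) with hS
  set H : ℂ[X] := (P.roots.map S).prod with hH
  have hDR : ∀ a b : R, a * b = 1 → aeval (a + b) D = a ^ p + b ^ p := fun a b hab => by
    rw [← dickson_one_one_eval_add_inv a b hab p, hD, ← eval_map_algebraMap, map_dickson, map_one]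
  have aeval_sub_dvd : ∀ (f : ℂ[X]) (a b : R), a - b ∣ aeval a f - aeval b f := fun f a b => by
    rw [← eval_map_algebraMap, ← eval_map_algebraMap]
    exact sub_dvd_eval_sub _ _ _
  have hS0 : ∀ l ∈ P.roots, S l ≠ 0 := fun l hl h => by
    rcases comp_eq_zero_iff.1 h with h | ⟨-, h⟩
    · exact hP.ne_zero h
    · refine dickson_add_comp_ne_C hp hp3 ?_ _ h
      rintro rfl
      exact hP0 (mem_roots hP.ne_zero |>.1 hl)
  have hH0 : H ≠ 0 := by
    refine Multiset.prod_ne_zero fun h => ?_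
    obtain ⟨l, hl, h⟩ := Multiset.mem_map.1 h
    exact hS0 l hl h
  have hfac : aeval (x + x' + y + y') P =
      (P.roots.map fun l => x + x' + y + y' - algebraMap ℂ R l).prod := by
    conv_lhs => rw [← prod_multiset_X_sub_C_of_monic_of_roots_card_eq hP
      (splits_iff_card_roots.1 (IsAlgClosed.splits P))]
    rw [map_multiset_prod, Multiset.map_map]
    simp
  have hmod : ∀ l, x + x' + y + y' - algebraMap ℂ R l ∣
      aeval (x + x') (S l) - aeval (x ^ p + x' ^ p + y ^ p + y' ^ p) P := fun l => by
    rw [hS, aeval_comp]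
    refine dvd_trans ?_ (aeval_sub_dvd P _ _)
    rw [map_add, aeval_comp, hDR x x' hx, map_sub, aeval_C, aeval_X,
      show x ^ p + x' ^ p + y ^ p + y' ^ p = x ^ p + x' ^ p + aeval (y + y') D by
        rw [hDR y y' hy]; ring, add_sub_add_left_eq_sub]
    refine dvd_trans ?_ (aeval_sub_dvd D _ _)
    exact ⟨-1, by ring⟩
  -- By `hmod` and `h₂`, each S l at x + x' is modulo I a multiple of T - l. Over all roots the
  -- factors T - l multiply to P(T), which lies in I.
  have hmem : ∀ s : Multiset ℂ, ∃ r : R, (s.map fun l => x + x' + y + y' - algebraMap ℂ R l).prod * r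
      - aeval (x + x') (s.map S).prod ∈ I := fun s => by
    induction s using Multiset.induction with
    | empty => exact ⟨1, by simp⟩
    | cons l s ih =>
      obtain ⟨r, hr⟩ := ih
      obtain ⟨t, ht⟩ := hmod l
      refine ⟨t * r, ?_⟩
      simp only [Multiset.map_cons, Multiset.prod_cons, map_mul]
      have := I.sub_mem (I.mul_mem_left (aeval (x + x') (S l)) hr)
        (I.mul_mem_left (r * (s.map fun l => x + x' + y + y' - algebraMap ℂ R l).prod) h₂)
      convert this using 1
      linear_combination (-r * (s.map fun l => x + x' + y + y' - algebraMap ℂ R l).prod) * ht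
  have hHmem : aeval (x + x') H ∈ I := by
    obtain ⟨r, hr⟩ := hmem P.roots
    rw [← hfac] at hr
    exact (Submodule.sub_mem_iff_right I (I.mul_mem_right r h₁)).1 hr
  -- This is X^N H(X + X⁻¹) with N = deg H. At 0 only k = N survives and leaves the leading
  -- coefficient of H.
  refine ⟨∑ k ∈ Finset.range (H.natDegree + 1), C (H.coeff k) * (X ^ (H.natDegree - k) *
    (X ^ 2 + 1) ^ k), fun h0 => ?_, ?_⟩
  · have := congrArg (eval 0) h0
    rw [eval_finsetSum, Finset.sum_range_succ, Finset.sum_eq_zero] at this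
    · simp [hH0] at this
    · intro k hk
      have : H.natDegree - k ≠ 0 := by have := Finset.mem_range.1 hk; omega
      simp [this]
  · have hpow : x ^ H.natDegree * aeval (x + x') H = aeval x (∑ k ∈ Finset.range (H.natDegree + 1),
        C (H.coeff k) * (X ^ (H.natDegree - k) * (X ^ 2 + 1) ^ k)) := by
      rw [aeval_eq_sum_range, Finset.mul_sum, map_sum]
      refine Finset.sum_congr rfl fun k hk => ?_
      obtain ⟨n, hn⟩ := Nat.exists_eq_add_of_le (Nat.lt_succ_iff.1 (Finset.mem_range.1 hk))
      simp only [map_mul, aeval_C, map_pow, map_add, aeval_X, map_one, hn, Nat.add_sub_cancel_left]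
      rw [show x ^ 2 + 1 = x * (x + x') by linear_combination -hx, Algebra.smul_def, mul_pow]
      ring
    rw [← hpow]
    exact I.mul_mem_left _ hHmem

/-! ### Freshman's dream and intertwining maps. -/

/-- Freshman's dream for integer polynomials in a sum of four elements. -/
theorem dvd_aeval_sum_pow_sub {R : Type*} [CommRing R] (P : ℤ[X]) {p : ℕ} (hp : p.Prime)
    (a b c d : R) : (p : R) ∣ aeval (a ^ p + b ^ p + c ^ p + d ^ p) P - aeval (a + b + c + d) P ^ p := by
  have : Fact p.Prime := ⟨hp⟩
  have hadd : ∀ s t : R, (p : R) ∣ (s + t) ^ p - (s ^ p + t ^ p) := fun s t => by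
    obtain ⟨r, hr⟩ := exists_add_pow_prime_eq hp s t
    exact ⟨s * t * r, by rw [hr]; ring⟩
  have h₁ : (p : R) ∣ (a ^ p + b ^ p + c ^ p + d ^ p) - (a + b + c + d) ^ p := by
    rw [← dvd_neg]
    convert dvd_add (dvd_add (hadd (a + b + c) d) (hadd (a + b) c)) (hadd a b) using 1
    ring
  have h₂ : (p : ℤ[X]) ∣ expand ℤ p P - P ^ p := by
    rw [show (p : ℤ[X]) = C (p : ℤ) by simp, C_dvd_iff_dvd_coeff]
    intro i
    rw [← ZMod.intCast_zmod_eq_zero_iff_dvd, ← eq_intCast (Int.castRingHom (ZMod p)), ← coeff_map]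
    simp [Polynomial.map_expand, ZMod.expand_card]
  have h₃ : (p : R) ∣ aeval ((a + b + c + d) ^ p) P - aeval (a + b + c + d) P ^ p := by
    have := _root_.map_dvd (aeval (a + b + c + d) : ℤ[X] →ₐ[ℤ] R) h₂
    simpa [expand_aeval] using this
  have h₄ : (p : R) ∣ aeval (a ^ p + b ^ p + c ^ p + d ^ p) P - aeval ((a + b + c + d) ^ p) P := by
    refine h₁.trans ?_
    rw [← eval_map_algebraMap, ← eval_map_algebraMap]
    exact sub_dvd_eval_sub _ _ _
  simpa using dvd_add h₄ h₃

/-- An additive map intertwining two endomorphisms intertwines all integer polynomials in them. -/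
theorem aeval_apply_intertwine {k K V W : Type*} [CommRing k] [CommRing K] [AddCommGroup V]
    [AddCommGroup W] [Module k V] [Module K W] {T : Module.End k V} {T' : Module.End K W}
    (j : V →+ W) (h : ∀ v, j (T v) = T' (j v)) (P : ℤ[X]) (v : V) :
    j (aeval T P v) = aeval T' P (j v) := by
  induction P using Polynomial.induction_on' with
  | add f g hf hg => simp [hf, hg]
  | monomial n a =>
    have hn : ∀ v, j ((T ^ n) v) = (T' ^ n) (j v) := by
      induction n with
      | zero => simp
      | succ n ih => intro v; simp [pow_succ, ih, h]
    simp [aeval_monomial, hn]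

end Polynomial
open Polynomial

/-! ### Periodicity from determinism. -/

/-- A forward deterministic two-sided sequence over a finite set of states is periodic. -/
theorem periodic_of_deterministic {S : Type*} [Fintype S] (s : ℤ → S)
    (h : ∀ a b, s a = s b → s (a + 1) = s (b + 1)) :
    Function.Periodic s ((Fintype.card S).factorial : ℤ) := by
  intro m
  have hfwd : ∀ (n : ℕ) (a b : ℤ), s a = s b → s (a + n) = s (b + n) := fun n => by
    induction n with
    | zero => simp
    | succ n ih =>
      intro a b hab
      push_cast
      rw [← add_assoc, ← add_assoc]
      exact h _ _ (ih a b hab)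
  -- The repetition is sought at positions up to m, so that forward determinism carries it to m. Its
  -- gap is at most card S, hence divides the factorial.
  obtain ⟨i, j, hij, hs⟩ := Fintype.exists_ne_map_eq_of_card_lt
    (fun i : Fin (Fintype.card S + 1) => s (m - Fintype.card S + (i : ℕ))) (by simp)
  wlog hlt : i < j generalizing i j
  · exact this j i hij.symm hs.symm (lt_of_le_of_ne (not_lt.1 hlt) hij.symm)
  obtain ⟨q, hq⟩ := Nat.exists_eq_add_of_lt (Fin.lt_def.1 hlt)
  have hj := j.2
  have hper : ∀ t : ℕ, s (m + t + (q + 1 : ℕ)) = s (m + t) := fun t => by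
    have := hfwd (Fintype.card S - i + t) _ _ hs
    have hi : (i : ℕ) ≤ Fintype.card S := by omega
    rw [show m + t = m - Fintype.card S + (i : ℕ) + (Fintype.card S - i + t : ℕ) by
      push_cast [hi]; ring, this]
    congr 1
    rw [hq]
    push_cast [hi]; ring
  have hmul : ∀ r : ℕ, s (m + ((q + 1) * r : ℕ)) = s m := fun r => by
    induction r with
    | zero => simp
    | succ r ih =>
      rw [← ih, ← hper ((q + 1) * r)]
      congr 1
      push_cast; ring
  obtain ⟨r, hr⟩ := Nat.dvd_factorial (Nat.succ_pos q) (show q + 1 ≤ Fintype.card S by omega)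
  rw [hr]
  exact hmul r

/-! ### The group algebra acting by translations. -/

section Action

variable {G : Type*} [AddCommGroup G]

/-- The translation action on functions `G → k`. -/
def translationHom (k G : Type*) [CommRing k] [AddCommGroup G] :
    Multiplicative G →* Module.End k (G → k) where
  toFun v := LinearMap.funLeft k k (· + v.toAdd)
  map_one' := by ext; simp [LinearMap.funLeft]
  map_mul' v w := by
    refine LinearMap.ext fun d => funext fun u => ?_
    simp [LinearMap.funLeft, add_assoc]

/-- The group algebra of `G` acts on functions `G → k` through translations. -/
noncomputable def translationAction (k G : Type*) [CommRing k] [AddCommGroup G] :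
    AddMonoidAlgebra k G →ₐ[k] Module.End k (G → k) :=
  AddMonoidAlgebra.lift k (Module.End k (G → k)) G (translationHom k G)

/-- The monomial of the group algebra with exponent `v`. -/
noncomputable def translationMonomial (k : Type*) [CommRing k] (v : G) : AddMonoidAlgebra k G :=
  AddMonoidAlgebra.single v 1

theorem translationMonomial_mul_neg (k : Type*) [CommRing k] (v : G) :
    translationMonomial k v * translationMonomial k (-v) = 1 := by
  simp [translationMonomial, AddMonoidAlgebra.single_mul_single, AddMonoidAlgebra.one_def]

theorem translationAction_monomial_pow (k : Type*) [CommRing k] (v : G) (n : ℕ) (d : G → k)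
    (u : G) : translationAction k G (translationMonomial k v ^ n) d u = d (u + n • v) := by
  simp [translationAction, translationMonomial, AddMonoidAlgebra.single_pow, translationHom,
    LinearMap.funLeft, AddMonoidAlgebra.lift_single]

/-- The ideal of the elements of the group algebra that annihilate `d`. -/
noncomputable def annihilatorIdeal {k : Type*} [CommRing k] (d : G → k) :
    Ideal (AddMonoidAlgebra k G) where
  carrier := {f | translationAction k G f d = 0}
  add_mem' {f g} hf hg := by
    simp only [Set.mem_ofPred_eq] at hf hg ⊢
    simp [hf, hg]
  zero_mem' := by simp
  smul_mem' f g hg := by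
    simp only [Set.mem_ofPred_eq] at hg ⊢
    simp [hg]

theorem mem_annihilatorIdeal {k : Type*} [CommRing k] {d : G → k} {f : AddMonoidAlgebra k G} :
    f ∈ annihilatorIdeal d ↔ translationAction k G f d = 0 := Iff.rfl

/-- A coloring annihilated by a nonzero polynomial in one monomial is periodic. -/
theorem exists_periodic_of_aeval_mem {k A : Type*} [Field k] [Fintype A] (f : A ↪ k)
    (c : G → A) (v : G) {Q : k[X]} (hQ : Q ≠ 0)
    (h : aeval (translationMonomial k v) Q ∈ annihilatorIdeal (f ∘ c)) :
    ∃ q : ℕ, 0 < q ∧ ∀ u, c (u + q • v) = c u := by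
  classical
  set N := Q.natDegree with hN
  have hrec : ∀ u, ∑ i ∈ Finset.range (N + 1), Q.coeff i * f (c (u + i • v)) = 0 := fun u => by
    have := congrFun (mem_annihilatorIdeal.1 h) u
    rw [aeval_eq_sum_range, map_sum] at this
    simpa [LinearMap.sum_apply, Finset.sum_apply, -map_pow, translationAction_monomial_pow] using this
  have hdet : ∀ u w, (∀ i < N, c (u + i • v) = c (w + i • v)) → c (u + N • v) = c (w + N • v) := by
    intro u w huw
    have h₁ := hrec u
    have h₂ := hrec w
    rw [Finset.sum_range_succ] at h₁ h₂
    rw [Finset.sum_congr rfl fun i hi => by rw [huw i (Finset.mem_range.1 hi)]] at h₁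
    have hlead : Q.coeff N ≠ 0 := by simpa [hN] using hQ
    exact f.injective (mul_left_cancel₀ hlead (add_left_cancel (h₁.trans h₂.symm)))
  refine ⟨(Fintype.card (Fin N → A)).factorial, Nat.factorial_pos _, fun u => ?_⟩
  -- The offset makes u the cell just after the window `s 0`; this also covers N = 0, where windows
  -- are empty.
  let s : ℤ → Fin N → A := fun m i => c (u - N • v + m • v + (i : ℕ) • v)
  have hs : ∀ a b, s a = s b →
      c (u - N • v + a • v + N • v) = c (u - N • v + b • v + N • v) := fun a b hab =>
    hdet _ _ fun i hi => congrFun hab ⟨i, hi⟩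
  have hper := periodic_of_deterministic s fun a b hab => by
    funext i
    simp only [s]
    have key : ∀ m : ℤ, u - N • v + (m + 1) • v + (i : ℕ) • v =
        u - N • v + m • v + ((i : ℕ) + 1) • v := fun m => by module
    rw [key, key]
    rcases Nat.lt_or_ge (i + 1) N with hi | hi
    · exact congrFun hab ⟨i + 1, hi⟩
    · rw [show (i : ℕ) + 1 = N by omega]
      exact hs a b hab
  have := hs _ _ (hper 0)
  convert this using 2
  · rw [zero_add, natCast_zsmul]; abel
  · simp

end Action

/-! ### Annihilators of a grid coloring. -/

/-- The `n`-th power sum `xⁿ + x⁻ⁿ + yⁿ + y⁻ⁿ` in the group algebra of `ℤ²`. -/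
noncomputable def gridPowerSum (k : Type*) [CommRing k] (n : ℕ) : AddMonoidAlgebra k (Fin 2 → ℤ) :=
  translationMonomial k ![1, 0] ^ n + translationMonomial k (-![1, 0]) ^ n +
    translationMonomial k ![0, 1] ^ n + translationMonomial k (-![0, 1]) ^ n

theorem translationAction_gridPowerSum (k : Type*) [CommRing k] (n : ℕ) (d : (Fin 2 → ℤ) → k)
    (u : Fin 2 → ℤ) : translationAction k _ (gridPowerSum k n) d u =
      d (u + n • ![1, 0]) + d (u + n • -![1, 0]) + d (u + n • ![0, 1]) + d (u + n • -![0, 1]) := by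
  simp only [gridPowerSum, map_add, LinearMap.add_apply, Pi.add_apply,
    translationAction_monomial_pow]

/-- Cayley-Hamilton for the transpose of M, transported by w ↦ w ∘ c. -/
theorem aeval_gridPowerSum_one_apply_comp {A : Type*} [Fintype A] [DecidableEq A]
    (c : Configuration 2 A) (M : Matrix A A ℤ)
    (hM : ∀ (w : A → ℤ) u, translationAction ℤ _ (gridPowerSum ℤ 1) (w ∘ c) u =
      Matrix.vecMul w M (c u)) (w : A → ℤ) :
    aeval (gridPowerSum ℤ 1) M.charpoly ∈ annihilatorIdeal (w ∘ c) := by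
  rw [mem_annihilatorIdeal, ← aeval_algHom_apply]
  let j : (A → ℤ) →+ ((Fin 2 → ℤ) → ℤ) := (LinearMap.funLeft ℤ ℤ c).toAddMonoidHom
  have := aeval_apply_intertwine (T := Matrix.toLin' M.transpose)
    (T' := translationAction ℤ _ (gridPowerSum ℤ 1)) j
    (fun w => funext fun u => by
      rw [Matrix.toLin'_apply, Matrix.mulVec_transpose]
      exact (hM w u).symm) M.charpoly w
  have hch : aeval (Matrix.toLin' M.transpose) M.charpoly = 0 := by
    rw [← Matrix.charpoly_transpose, ← Matrix.charpoly_toLin', LinearMap.aeval_self_charpoly]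
  rw [hch] at this
  rw [LinearMap.zero_apply, map_zero] at this
  exact this.symm

/-- Translations preserve uniform bounds, so K depends on P alone and a prime exponent n can be
chosen after it. -/
theorem exists_forall_abs_aeval_gridPowerSum_le (P : ℤ[X]) : ∃ K : ℤ, ∀ (n : ℕ) (m : ℤ)
    (d : (Fin 2 → ℤ) → ℤ), (∀ u, |d u| ≤ m) →
      ∀ u, |translationAction ℤ _ (aeval (gridPowerSum ℤ n) P) d u| ≤ K * m := by
  have hone : ∀ (n : ℕ) (m : ℤ) (d : (Fin 2 → ℤ) → ℤ), (∀ u, |d u| ≤ m) →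
      ∀ u, |translationAction ℤ _ (gridPowerSum ℤ n) d u| ≤ 4 * m := fun n m d hd u => by
    rw [translationAction_gridPowerSum, abs_le]
    have h₁ := abs_le.1 (hd (u + n • ![1, 0]))
    have h₂ := abs_le.1 (hd (u + n • -![1, 0]))
    have h₃ := abs_le.1 (hd (u + n • ![0, 1]))
    have h₄ := abs_le.1 (hd (u + n • -![0, 1]))
    constructor <;> linarith
  induction P using Polynomial.induction_on' with
  | add f g hf hg =>
    obtain ⟨K, hK⟩ := hf
    obtain ⟨L, hL⟩ := hg
    refine ⟨K + L, fun n m d hd u => ?_⟩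
    rw [map_add, map_add, LinearMap.add_apply, Pi.add_apply, add_mul]
    exact (abs_add_le _ _).trans (add_le_add (hK n m d hd u) (hL n m d hd u))
  | monomial r a =>
    refine ⟨|a| * 4 ^ r, fun n m d hd u => ?_⟩
    have hpow : ∀ u, |translationAction ℤ _ (gridPowerSum ℤ n ^ r) d u| ≤ 4 ^ r * m := by
      induction r with
      | zero => simpa using hd
      | succ r ih =>
        intro u
        rw [pow_succ', pow_succ', mul_assoc, map_mul]
        exact hone n _ _ ih u
    rw [aeval_monomial, map_mul, AlgHom.commutes, Module.End.mul_apply, Module.algebraMap_end_apply,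
      Pi.smul_apply, smul_eq_mul, abs_mul, mul_assoc]
    exact mul_le_mul_of_nonneg_left (hpow u) (abs_nonneg a)

/-- Raising the variables to a large prime power preserves annihilation of bounded functions. -/
theorem exists_prime_aeval_gridPowerSum_mem (P : ℤ[X]) {d : (Fin 2 → ℤ) → ℤ} {m : ℤ}
    (hd : ∀ u, |d u| ≤ m) (h : aeval (gridPowerSum ℤ 1) P ∈ annihilatorIdeal d) :
    ∃ p : ℕ, Odd p ∧ 3 ≤ p ∧ aeval (gridPowerSum ℤ p) P ∈ annihilatorIdeal d := by
  obtain ⟨K, hK⟩ := exists_forall_abs_aeval_gridPowerSum_le P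
  -- With p > K * m, a value divisible by p and bounded by K * m vanishes.
  obtain ⟨p, hp, hprime⟩ := Nat.exists_infinite_primes ((K * m).toNat + 3)
  refine ⟨p, hprime.odd_of_ne_two (by omega), by omega, ?_⟩
  obtain ⟨g, hg⟩ := dvd_aeval_sum_pow_sub P hprime (translationMonomial ℤ (![1, 0] : Fin 2 → ℤ))
    (translationMonomial ℤ (-![1, 0])) (translationMonomial ℤ ![0, 1])
    (translationMonomial ℤ (-![0, 1]))
  have hsum : aeval (gridPowerSum ℤ p) P = p * g + aeval (gridPowerSum ℤ 1) P ^ p := by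
    rw [← hg]
    simp only [gridPowerSum, pow_one]
    exact (sub_add_cancel _ _).symm
  have hmem := mem_annihilatorIdeal.1 (Ideal.pow_mem_of_mem _ h p hprime.pos)
  rw [mem_annihilatorIdeal]
  funext u
  have hdvd : (p : ℤ) ∣ translationAction ℤ _ (aeval (gridPowerSum ℤ p) P) d u := by
    refine ⟨translationAction ℤ _ g d u, ?_⟩
    rw [hsum, map_add, LinearMap.add_apply, hmem, add_zero, map_mul, map_natCast,
      Module.End.mul_apply]
    simp
  refine Int.eq_zero_of_abs_lt_dvd hdvd ((hK p m d hd u).trans_lt ?_)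
  omega

/-- Passage to ℂ, where P splits, as the elimination requires. -/
theorem aeval_gridPowerSum_map_mem (P : ℤ[X]) (n : ℕ) {d : (Fin 2 → ℤ) → ℤ}
    (h : aeval (gridPowerSum ℤ n) P ∈ annihilatorIdeal d) :
    aeval (gridPowerSum ℂ n) (P.map (Int.castRingHom ℂ)) ∈
      annihilatorIdeal (fun u => (d u : ℂ)) := by
  rw [mem_annihilatorIdeal, ← aeval_algHom_apply] at h ⊢
  let j : ((Fin 2 → ℤ) → ℤ) →+ ((Fin 2 → ℤ) → ℂ) := (Int.castAddHom ℂ).compLeft _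
  have := aeval_apply_intertwine (T := translationAction ℤ _ (gridPowerSum ℤ n))
    (T' := translationAction ℂ _ (gridPowerSum ℂ n)) j (fun d => funext fun u => by
      rw [translationAction_gridPowerSum]
      change ((translationAction ℤ _ (gridPowerSum ℤ n) d u : ℤ) : ℂ) = _
      rw [translationAction_gridPowerSum]
      push_cast
      rfl) P d
  rw [h, map_zero] at this
  rw [← algebraMap_int_eq, aeval_map_algebraMap]
  exact this.symm

theorem exists_periods {A : Type*} [Fintype A] [DecidableEq A]
    (c : Configuration 2 A) (M : Matrix A A ℤ) (hdet : M.det ≠ 0)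
    (hM : ∀ (w : A → ℤ) u, translationAction ℤ _ (gridPowerSum ℤ 1) (w ∘ c) u =
      Matrix.vecMul w M (c u)) :
    (∃ q : ℕ, 0 < q ∧ ∀ u, c (u + q • ![1, 0]) = c u) ∧
      ∃ q : ℕ, 0 < q ∧ ∀ u, c (u + q • ![0, 1]) = c u := by
  -- Injectivity of this labelling lets c be recovered from w ∘ c.
  let w : A → ℤ := fun a => (Fintype.equivFin A a : ℕ)
  have hw : ∀ u, |(w ∘ c) u| ≤ (Fintype.card A : ℤ) := fun u => by
    simp [w]
  have h₁ := aeval_gridPowerSum_one_apply_comp c M hM w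
  obtain ⟨p, hodd, hp3, hp⟩ := exists_prime_aeval_gridPowerSum_mem _ hw h₁
  replace h₁ := aeval_gridPowerSum_map_mem _ _ h₁
  replace hp := aeval_gridPowerSum_map_mem _ _ hp
  let f : A ↪ ℂ := ⟨fun a => (w a : ℂ), fun a b hab => by
    have : w a = w b := Int.cast_injective (α := ℂ) hab
    simpa [w, Fin.val_inj] using this⟩
  change _ ∈ annihilatorIdeal (f ∘ c) at h₁ hp
  have hmon : (M.charpoly.map (Int.castRingHom ℂ)).Monic := M.charpoly_monic.map _
  have h0 : (M.charpoly.map (Int.castRingHom ℂ)).eval 0 ≠ 0 := by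
    rw [← coeff_zero_eq_eval_zero, coeff_map]
    intro h
    rw [Matrix.det_eq_sign_charpoly_coeff] at hdet
    have : M.charpoly.coeff 0 = 0 := by simpa using h
    exact hdet (by rw [this, mul_zero])
  constructor
  · obtain ⟨Q, hQ, hQm⟩ := exists_aeval_mem_of_laurent (annihilatorIdeal (f ∘ c))
      (translationMonomial_mul_neg ℂ ![1, 0]) (translationMonomial_mul_neg ℂ ![0, 1]) hmon h0 hodd
      hp3 (by simpa [gridPowerSum] using h₁) (by simpa [gridPowerSum] using hp)
    exact exists_periodic_of_aeval_mem f c _ hQ hQm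
  · have hsymm : ∀ n, gridPowerSum ℂ n = translationMonomial ℂ ![0, 1] ^ n +
        translationMonomial ℂ (-![0, 1]) ^ n + translationMonomial ℂ ![1, 0] ^ n +
        translationMonomial ℂ (-![1, 0]) ^ n := fun n => by
      rw [gridPowerSum]
      ac_rfl
    obtain ⟨Q, hQ, hQm⟩ := exists_aeval_mem_of_laurent (annihilatorIdeal (f ∘ c))
      (translationMonomial_mul_neg ℂ ![0, 1]) (translationMonomial_mul_neg ℂ ![1, 0]) hmon h0 hodd
      hp3 (by simpa [hsymm] using h₁) (by simpa [hsymm] using hp)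
    exact exists_periodic_of_aeval_mem f c _ hQ hQm

/-! ### From neighbor counts to two-periodicity. -/

/-- The closed unit ball of the square grid. -/
def gridBall : Finset (Fin 2 → ℤ) := {0, ![1, 0], -![1, 0], ![0, 1], -![0, 1]}

theorem sum_gridBall {N : Type*} [AddCommMonoid N] (g : (Fin 2 → ℤ) → N) :
    ∑ v ∈ gridBall, g v = g 0 + (g ![1, 0] + (g (-![1, 0]) + (g ![0, 1] + g (-![0, 1])))) := by
  rw [gridBall, Finset.sum_insert (by decide), Finset.sum_insert (by decide),
    Finset.sum_insert (by decide), Finset.sum_insert (by decide), Finset.sum_singleton]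

theorem graphNeighborhood_squareGrid_one (u : Fin 2 → ℤ) :
    graphNeighborhood squareGrid 1 u = (fun w => u + w) '' (gridBall : Set (Fin 2 → ℤ)) := by
  ext v
  have hneg : (-![1, 0] : Fin 2 → ℤ) = ![-1, 0] ∧ (-![0, 1] : Fin 2 → ℤ) = ![0, -1] := by decide
  simp only [graphNeighborhood, Set.mem_ofPred_eq, Nat.cast_one,
    SimpleGraph.edist_le_one_iff_adj_or_eq, squareGrid, gridBall, hneg, Set.mem_image,
    Finset.mem_coe, Finset.mem_insert, Finset.mem_singleton, Set.mem_insert_iff,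
    Set.mem_singleton_iff]
  constructor
  · intro h
    refine ⟨v - u, ?_, add_sub_cancel _ _⟩
    rw [sub_eq_zero]
    tauto
  · rintro ⟨w, hw, rfl⟩
    rw [add_sub_cancel_left]
    rcases hw with rfl | hw
    · simp
    · exact Or.inl hw

theorem isTwoPeriodic_of_ncard {A : Type*} [Fintype A] [DecidableEq A] (c : Configuration 2 A)
    (B : Matrix A A ℤ) (hB : (B - 1).det ≠ 0)
    (h : ∀ i u, (({v ∈ (fun w => u + w) '' (gridBall : Set (Fin 2 → ℤ)) | c v = i}.ncard : ℕ) : ℤ) =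
      B i (c u)) : c.IsTwoPeriodic := by
  have hcount : ∀ i u, ∑ v ∈ gridBall, (if c (u + v) = i then (1 : ℤ) else 0) = B i (c u) := by
    intro i u
    rw [← h i u, Finset.sum_boole]
    congr 1
    have : {v ∈ (fun w => u + w) '' (gridBall : Set (Fin 2 → ℤ)) | c v = i} =
        (fun w => u + w) '' ((gridBall.filter fun v => c (u + v) = i : Finset _) : Set _) := by
      ext v
      simp only [Set.mem_ofPred_eq, Set.mem_image, Finset.mem_coe, Finset.mem_filter]
      constructor
      · rintro ⟨⟨w, hw, rfl⟩, hv⟩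
        exact ⟨w, ⟨hw, hv⟩, rfl⟩
      · rintro ⟨w, ⟨hw, hv⟩, rfl⟩
        exact ⟨⟨w, hw, rfl⟩, hv⟩
    rw [this, Set.ncard_image_of_injective _ (add_right_injective u), Set.ncard_coe_finset]
  -- Subtracting the identity removes the center of the ball from the count.
  obtain ⟨⟨q, hq, hqc⟩, r, hr, hrc⟩ := exists_periods c (B - 1) hB fun w u => by
    have hsum : ∑ v ∈ gridBall, w (c (u + v)) = ∑ i, w i * B i (c u) := by
      simp_rw [← hcount, Finset.mul_sum]
      rw [Finset.sum_comm]
      simp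
    rw [sum_gridBall, add_zero] at hsum
    rw [translationAction_gridPowerSum, Matrix.vecMul_sub, Matrix.vecMul_one]
    simp only [one_smul, Function.comp_apply, Pi.sub_apply]
    change _ = ∑ i, w i * B i (c u) - _
    rw [← hsum]
    ring
  refine ⟨![q • ![1, 0], r • ![0, 1]], ?_, fun i => funext fun u => ?_⟩
  · rw [LinearIndependent.pair_iff]
    intro a b hab
    have h0 := congrFun hab 0
    have h1 := congrFun hab 1
    simp at h0 h1
    omega
  · fin_cases i
    · exact (hqc _).symm.trans (congrArg c (sub_add_cancel u _))
    · exact (hrc _).symm.trans (congrArg c (sub_add_cancel u _))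

theorem mainTheorem9 {A : Type*} [Fintype A] [DecidableEq A] (c : Configuration 2 A)
    (B : Matrix A A ℤ) (hB : (B - 1).det ≠ 0) :
    (c.IsPerfectColoring (relativeNeighborhood squareGrid 1) B → c.IsTwoPeriodic) ∧
      (IsGraphPerfectColoring squareGrid 1 c B → c.IsTwoPeriodic) := by
  constructor
  · rintro ⟨-, h⟩
    have hball : relativeNeighborhood squareGrid 1 = gridBall := by
      rw [relativeNeighborhood, graphNeighborhood_squareGrid_one]
      simp
    rw [hball] at h
    exact isTwoPeriodic_of_ncard c B hB fun i u => h i _ u rfl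
  · rintro ⟨-, h⟩
    refine isTwoPeriodic_of_ncard c B hB fun i u => ?_
    rw [← graphNeighborhood_squareGrid_one]
    exact h i _ u rfl
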